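/- **Model.** $G=(V,E,\omega)$ is a connected undirected graph with vertex names $V=\{0,\dots,n-1\}$ and edge weights $\omega:E\to\mathbb R_{>0}$. Write $d$ for its shortest-path distance and $D=\max_{u,v}d(u,v)/\min_{u\ne v}d(u,v)$ for its normalized diameter. $B(u,\ell)$ is the set of the $\ell$ vertices closest to $u$ ($u$ included, all of $V$ if $\ell>n$), with ties broken by vertex name. For a fixed constant $\alpha>0$ put $\tilde q=\lceil\alpha q\log_2 n\rceil$. The notation $\tilde O(\cdot)$ hides factors $C(\log_2 n)^{k}$. Routing is in the fixed port model: at each vertex $u$ the incident links are numbered $0,\dots,\deg(u)-1$ in an arbitrary, given order. A routing scheme consists of a local algorithm, which does not depend on the graph, and of a routing table (a bit string) for every vertex. The source computes the initial header (a bit string) from its table and the name of the destination. Every vertex that receives the message computes from its own table and the header alone either that the message is delivered there, or a port and the new header with which the message is forwarded. **Statement.** There is a local algorithm such that the following holds. Let $\mathcal W=\{W_1,\dots,W_q\}$ be a partition of a set $W\subseteq V$ into $q$ (possibly empty) sets, each of size $\tilde O(|W|/q)$. Let $\mathcal U=\{U_1,\dots,U_q\}$ be a partition of $V$ into $q$ sets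 such that $U_i\cap B(u,\tilde q)\neq\emptyset$ for all $1\le i\le q$ and $u\in V$. Then for every $\varepsilon>0$ there are routing tables such that: * for every $1\le i\le q$, every $u\in U_i$ and every $w\in W_i$, a message from $u$ to $w$ is delivered at $w$ along a walk of length at most $(1+\varepsilon)\,d(u,w)$; * every header used on the way has $O\big((1+\tfrac1\varepsilon)\,(1+\log_2 D)\,\log_2 n\big)$ bits, that is, the size of $O((1+\frac1\varepsilon)(1+\log_2 D))$ vertex names; * the routing table of every vertex has $\tilde O\big(q+(1+\tfrac1\varepsilon)(1+\log_2 D)\,|W|/q\big)$ bits. The constant in the header bound is absolute. The constant and the exponent in the table bound depend only on $\alpha$ and on the constant and exponent in the bound $|W_i|=\tilde O(|W|/q)$. -/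

import Mathlib

noncomputable section

/-- A connected undirected graph on the vertex names `0, …, n - 1` with positive real edge weights. -/
structure WeightedGraph (n : ℕ) where
  graph : SimpleGraph (Fin n)
  connected : graph.Connected
  weight : Sym2 (Fin n) → ℝ
  weight_pos : ∀ e ∈ graph.edgeSet, 0 < weight e

namespace WeightedGraph

variable {n : ℕ} (N : WeightedGraph n)

/-- The length of a walk: the sum of the weights of its edges, with multiplicity. -/
def walkLength {u v : Fin n} (p : N.graph.Walk u v) : ℝ :=
  (p.edges.map N.weight).sum

/-- The length of a shortest path. -/
def dist (u v : Fin n) : ℝ :=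
  ⨅ p : N.graph.Walk u v, N.walkLength p

/-- The normalized diameter: the largest distance divided by the smallest distance between
distinct vertices. -/
def normalizedDiameter : ℝ :=
  (⨆ p : Fin n × Fin n, N.dist p.1 p.2) /
    (⨅ p : {p : Fin n × Fin n // p.1 ≠ p.2}, N.dist p.1.1 p.1.2)

/-- The `l` vertices closest to `u` (`u` itself included), ties broken by vertex name:
`v` belongs to it when fewer than `l` vertices precede `v`. -/
def vicinity (u : Fin n) (l : ℕ) : Set (Fin n) :=
  {v | {x : Fin n | N.dist u x < N.dist u v ∨ (N.dist u x = N.dist u v ∧ x < v)}.ncard < l}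

/-- A port numbering (fixed port model): at every vertex `u`, the links to the neighbours of `u`
carry the numbers `0, …, deg u - 1` in some order, over which the routing scheme has no control. -/
def PortNumbering : Type :=
  ∀ u : Fin n, N.graph.neighborSet u ≃ Fin (N.graph.neighborSet u).ncard

end WeightedGraph

/-- The local algorithm of a routing scheme, run at every vertex of every network. All that it knows
about the network is the routing table of the vertex at which it runs.
* `start table w` is the header with which the source, holding `table`, sends a message to the
  vertex named `w`.
* `step table header` is the decision at a vertex holding `table` that has received a message
  carrying `header`: `none` if the message is to be delivered here, and `some (p, header')` if it is
  to be forwarded through port `p` with the header `header'`. -/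
structure LocalRouter where
  start : List Bool → ℕ → List Bool
  step : List Bool → List Bool → Option (ℕ × List Bool)

namespace LocalRouter

variable (R : LocalRouter) {n : ℕ} (N : WeightedGraph n) (port : N.PortNumbering)
  (table : Fin n → List Bool) (H : ℝ)

/-- A message that is at `x` with the header `h` traverses exactly the walk `p` and is delivered at
its end, and its header never has more than `H` bits. -/
def Traverses : {x y : Fin n} → N.graph.Walk x y → List Bool → Prop
  | x, _, .nil, h => (h.length : ℝ) ≤ H ∧ R.step (table x) h = none
  | x, _, .cons (v := z) hxz p, h => (h.length : ℝ) ≤ H ∧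
      ∃ h' : List Bool, R.step (table x) h = some ((port x ⟨z, hxz⟩ : ℕ), h') ∧ Traverses p h'

/-- With the routing tables `table`, a message from `u` to `w` is delivered at `w`, along a walk of
length at most `s` times the distance, with headers of at most `H` bits. -/
def RoutesWithStretch (s : ℝ) (u w : Fin n) : Prop :=
  ∃ p : N.graph.Walk u w,
    R.Traverses N port table H p (R.start (table u) w) ∧ N.walkLength p ≤ s * N.dist u w

end LocalRouter

/-- `P` is a partition of `S` into `q` indexed sets. -/
def IsIndexedPartition {n q : ℕ} (P : Fin q → Finset (Fin n)) (S : Finset (Fin n)) : Prop :=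
  (∀ i j : Fin q, i ≠ j → Disjoint (P i) (P j)) ∧ ∀ v : Fin n, v ∈ S ↔ ∃ i : Fin q, v ∈ P i

end

/-!
A message travels along waypoints: pairs `(y, p)` telling it to reach the vertex `y` and to leave it
through the port `p`. A waypoint in the vicinity of the current vertex is reached by shortest-path
routing, because vicinities are closed under moving along shortest paths.

The vertex `u` stores for `w` a list of waypoints along a shortest path to `w`: at a vertex `x` of
that path, go to `w` if it lies in the vicinity of `x`; otherwise look at a vertex `t` of the
vicinity that also knows a way to `w`. If `d(x, t) ≤ ε / (2 + ε) * d(u, x)`, go to `t` and start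
afresh: the length `d(u, x) + d(x, t)` of this stage is at most `1 + ε` times its gain
`d(u, w) - d(t, w)`, so the stages add up to stretch `1 + ε`. If `t` is farther away, the edge by
which the path leaves the vicinity of `x` ends at distance more than
`(1 + ε / (2 + ε)) * d(u, x)` from `u`. This can only happen `O((1 + 1 / ε) * (1 + log₂ D))` times,
which bounds the number of waypoints.
-/

/-! ### Self-delimiting codes -/

/-- A self-delimiting binary code, the format of headers and routing tables: from a bit string that
starts with a code word, the element encoded and the rest of the string can be recovered. -/
structure PrefixCode (β : Type*) where
  encode : β → List Bool
  append_inj : ∀ {a b : β} {s t : List Bool}, encode a ++ s = encode b ++ t → a = b ∧ s = t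

theorem one_le_logb_two {x : ℝ} (hx : 2 ≤ x) : 1 ≤ Real.logb 2 x := by
  rwa [Real.le_logb_iff_rpow_le one_lt_two (by linarith), Real.rpow_one]

theorem natSize_le_logb_two_add_one {m n : ℕ} (hm : m < n) :
    (m.size : ℝ) ≤ Real.logb 2 n + 1 := by
  have hsize : m.size ≤ Nat.log 2 n + 1 :=
    Nat.size_le.2 (hm.trans (Nat.lt_pow_succ_log_self one_lt_two n))
  calc (m.size : ℝ) ≤ Nat.log 2 n + 1 := by exact_mod_cast hsize
    _ ≤ Real.logb 2 n + 1 := by gcongr; exact_mod_cast Real.natLog_le_logb n 2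

namespace PrefixCode

variable {β γ : Type*}

theorem encode_injective (f : PrefixCode β) : Function.Injective f.encode :=
  fun _ _ h => (f.append_inj (congrArg (· ++ []) h)).1

/-- The decoder of a code; bit strings that are not code words are sent to `none`. -/
noncomputable def decode (f : PrefixCode β) : List Bool → Option β :=
  Function.partialInv f.encode

theorem decode_encode (f : PrefixCode β) (a : β) : f.decode (f.encode a) = some a :=
  Function.partialInv_left f.encode_injective a

/-- The code of `β` obtained by embedding `β` into a type that has a code. -/
def comap (f : PrefixCode γ) (e : β → γ) (he : Function.Injective e) : PrefixCode β where
  encode b := f.encode (e b)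
  append_inj h := (f.append_inj h).imp_left fun hab => he hab

/-- The code of pairs by concatenation. -/
def prod (f : PrefixCode β) (g : PrefixCode γ) : PrefixCode (β × γ) where
  encode p := f.encode p.1 ++ g.encode p.2
  append_inj {a b s t} h := by
    simp only [List.append_assoc] at h
    obtain ⟨hfst, h⟩ := f.append_inj h
    obtain ⟨hsnd, hst⟩ := g.append_inj h
    exact ⟨Prod.ext hfst hsnd, hst⟩

/-- The code words of `PrefixCode.list`: each entry is announced by `true`, the end by `false`. -/
def encodeList (f : PrefixCode β) : List β → List Bool
  | [] => [false]
  | a :: l => true :: (f.encode a ++ encodeList f l)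

/-- The code of lists over a type that has a code. -/
def list (f : PrefixCode β) : PrefixCode (List β) where
  encode := f.encodeList
  append_inj {l} := by
    induction l with
    | nil =>
      rintro (_ | ⟨b, m⟩) s t h
      · simpa [encodeList] using h
      · simp [encodeList] at h
    | cons a l ih =>
      rintro (_ | ⟨b, m⟩) s t h
      · simp [encodeList] at h
      · simp only [encodeList, List.cons_append, List.append_assoc, List.cons.injEq,
          true_and] at h
        obtain ⟨rfl, htail⟩ := f.append_inj h
        obtain ⟨rfl, rfl⟩ := ih htail
        exact ⟨rfl, rfl⟩

/-- The code of a bit by itself. -/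
def bool : PrefixCode Bool where
  encode b := [b]
  append_inj h := by simpa using h

theorem bits_injective : Function.Injective Nat.bits := fun a b h =>
  Nat.digits_inj_iff.1 (by rw [Nat.digits_two_eq_bits, Nat.digits_two_eq_bits, h])

/-- The code of natural numbers by their binary digits. -/
def nat : PrefixCode ℕ :=
  bool.list.comap Nat.bits bits_injective

theorem length_encode_prod (f : PrefixCode β) (g : PrefixCode γ) (p : β × γ) :
    ((f.prod g).encode p).length = (f.encode p.1).length + (g.encode p.2).length :=
  List.length_append

theorem length_encode_list_le (f : PrefixCode β) {c : ℝ} {l : List β}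
    (h : ∀ a ∈ l, ((f.encode a).length : ℝ) ≤ c) :
    ((f.list.encode l).length : ℝ) ≤ 1 + l.length * (1 + c) := by
  induction l with
  | nil => simp [list, encodeList]
  | cons a l ih =>
    obtain ⟨ha, hl⟩ := List.forall_mem_cons.1 h
    have hrec := ih hl
    simp only [list, encodeList, List.length_cons, List.length_append] at hrec ⊢
    push_cast
    linarith

theorem length_encode_nat_le {m n : ℕ} (hn : 2 ≤ n) (hm : m < n) :
    ((nat.encode m).length : ℝ) ≤ 5 * Real.logb 2 n := by
  have hlog : 1 ≤ Real.logb 2 n := one_le_logb_two (by exact_mod_cast hn)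
  have hsize := natSize_le_logb_two_add_one hm
  rw [← Nat.size_eq_bits_len] at hsize
  calc ((nat.encode m).length : ℝ) ≤ 1 + m.bits.length * (1 + 1) :=
        bool.length_encode_list_le (by simp [bool])
    _ ≤ 5 * Real.logb 2 n := by linarith

end PrefixCode

/-! ### The routing algorithm -/

/-- A list of waypoints: the pair `(y, p)` tells a message to go to the vertex named `y` and to
leave it through the port `p`. -/
abbrev Waypoints : Type := List (ℕ × ℕ)

/-- The contents of a header: the name of the destination and the waypoints still ahead. -/
structure MessageHeader where
  dest : ℕ
  waypoints : Waypoints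

/-- The contents of the routing table of a vertex: its name, pairs `(v, p)` of a nearby vertex `v`
and a port `p` that leads towards it, and waypoints for some destinations. -/
structure RoutingTable where
  name : ℕ
  ports : List (ℕ × ℕ)
  routes : List (ℕ × Waypoints)

/-- The binary code of lists of waypoints, and of any other lists of pairs of natural numbers. -/
def waypointsCode : PrefixCode Waypoints :=
  (PrefixCode.nat.prod PrefixCode.nat).list

/-- The binary code of headers. -/
def headerCode : PrefixCode MessageHeader :=
  (PrefixCode.nat.prod waypointsCode).comap (fun h => (h.dest, h.waypoints))
    fun ⟨_, _⟩ ⟨_, _⟩ h => by simpa using h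

/-- The binary code of routing tables. -/
def tableCode : PrefixCode RoutingTable :=
  (PrefixCode.nat.prod (waypointsCode.prod (PrefixCode.nat.prod waypointsCode).list)).comap
    (fun T => (T.name, T.ports, T.routes)) fun ⟨_, _, _⟩ ⟨_, _, _⟩ h => by simpa using h

theorem length_encode_waypointsCode_le {n : ℕ} (hn : 2 ≤ n) {L : Waypoints}
    (hL : ∀ e ∈ L, e.1 < n ∧ e.2 < n) :
    ((waypointsCode.encode L).length : ℝ) ≤ 1 + 11 * L.length * Real.logb 2 n := by
  have hlog : 1 ≤ Real.logb 2 n := one_le_logb_two (by exact_mod_cast hn)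
  have hentry : ∀ e ∈ L, (((PrefixCode.nat.prod PrefixCode.nat).encode e).length : ℝ) ≤
      10 * Real.logb 2 n := fun e he => by
    rw [PrefixCode.length_encode_prod]
    push_cast
    linarith [PrefixCode.length_encode_nat_le hn (hL e he).1,
      PrefixCode.length_encode_nat_le hn (hL e he).2]
  calc ((waypointsCode.encode L).length : ℝ) ≤ 1 + L.length * (1 + 10 * Real.logb 2 n) :=
        PrefixCode.length_encode_list_le _ hentry
    _ ≤ 1 + L.length * (11 * Real.logb 2 n) := by gcongr; linarith
    _ = 1 + 11 * L.length * Real.logb 2 n := by ring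

theorem length_encode_headerCode_le {n : ℕ} (hn : 2 ≤ n) {h : MessageHeader} (hdest : h.dest < n)
    (hway : ∀ e ∈ h.waypoints, e.1 < n ∧ e.2 < n) :
    ((headerCode.encode h).length : ℝ) ≤ (6 + 11 * h.waypoints.length) * Real.logb 2 n := by
  have hlog : 1 ≤ Real.logb 2 n := one_le_logb_two (by exact_mod_cast hn)
  have hbits := length_encode_waypointsCode_le hn hway
  have hname := PrefixCode.length_encode_nat_le hn hdest
  have hsplit : (headerCode.encode h).length =
      (PrefixCode.nat.encode h.dest).length + (waypointsCode.encode h.waypoints).length :=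
    PrefixCode.length_encode_prod ..
  rw [hsplit]
  push_cast
  linarith

theorem length_encode_tableCode_le {n : ℕ} (hn : 2 ≤ n) {T : RoutingTable} {K : ℝ}
    (hname : T.name < n) (hports : ∀ e ∈ T.ports, e.1 < n ∧ e.2 < n)
    (hroutes : ∀ r ∈ T.routes, r.1 < n ∧ (r.2.length : ℝ) ≤ K ∧ ∀ e ∈ r.2, e.1 < n ∧ e.2 < n) :
    ((tableCode.encode T).length : ℝ) ≤
      (7 + 11 * T.ports.length + (7 + 11 * K) * T.routes.length) * Real.logb 2 n := by
  have hlog : 1 ≤ Real.logb 2 n := one_le_logb_two (by exact_mod_cast hn)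
  have hroute : ∀ r ∈ T.routes, (((PrefixCode.nat.prod waypointsCode).encode r).length : ℝ) ≤
      (6 + 11 * K) * Real.logb 2 n := fun r hr => by
    obtain ⟨hdest, hlen, hway⟩ := hroutes r hr
    refine (length_encode_headerCode_le (h := ⟨r.1, r.2⟩) hn hdest hway).trans ?_
    gcongr
  have hbits : (((PrefixCode.nat.prod waypointsCode).list.encode T.routes).length : ℝ) ≤
      1 + (7 + 11 * K) * T.routes.length * Real.logb 2 n := by
    calc _ ≤ 1 + T.routes.length * (1 + (6 + 11 * K) * Real.logb 2 n) :=
          PrefixCode.length_encode_list_le _ hroute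
      _ ≤ 1 + T.routes.length * ((7 + 11 * K) * Real.logb 2 n) := by gcongr; linarith
      _ = _ := by ring
  have hsplit : (tableCode.encode T).length =
      (PrefixCode.nat.encode T.name).length + ((waypointsCode.encode T.ports).length +
        ((PrefixCode.nat.prod waypointsCode).list.encode T.routes).length) := by
    rw [← PrefixCode.length_encode_prod _ _ (T.ports, T.routes)]
    exact PrefixCode.length_encode_prod ..
  rw [hsplit]
  push_cast
  linarith [PrefixCode.length_encode_nat_le hn hname, length_encode_waypointsCode_le hn hports]

/-- Forwarding a message to `w` towards the first of the given waypoints: the port and the new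
header. Without waypoints there is nowhere to go. -/
def RoutingTable.forward (T : RoutingTable) (w : ℕ) : Waypoints → Option (ℕ × MessageHeader)
  | [] => none
  | (y, p) :: L =>
    if T.name = y then some (p, ⟨w, L⟩)
    else (T.ports.lookup y).map fun p' => (p', ⟨w, (y, p) :: L⟩)

/-- The decision at a vertex holding `T`. A message without waypoints is delivered at its
destination, and takes new waypoints from the table anywhere else. -/
def RoutingTable.step (T : RoutingTable) : MessageHeader → Option (ℕ × MessageHeader)
  | ⟨w, []⟩ => if T.name = w then none else (T.routes.lookup w).bind (T.forward w)
  | ⟨w, e :: L⟩ => T.forward w (e :: L)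

/-- The local algorithm that routes along waypoints. -/
noncomputable def waypointRouter : LocalRouter where
  start _ w := headerCode.encode ⟨w, []⟩
  step t h := do
    let (p, h') ← (← tableCode.decode t).step (← headerCode.decode h)
    return (p, headerCode.encode h')

theorem waypointRouter_step_encode (T : RoutingTable) (h : MessageHeader) :
    waypointRouter.step (tableCode.encode T) (headerCode.encode h) =
      (T.step h).map fun r => (r.1, headerCode.encode r.2) := by
  simp only [waypointRouter, PrefixCode.decode_encode, Option.bind_eq_bind, Option.bind_some]
  cases T.step h <;> rfl

theorem lookup_map_mk_of_injective {α β γ : Type*} [BEq β] [LawfulBEq β] {f : α → β}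
    (hf : Function.Injective f) (g : α → γ) {a : α} {l : List α} (ha : a ∈ l) :
    (l.map fun x => (f x, g x)).lookup (f a) = some (g a) := by
  induction l with
  | nil => simp at ha
  | cons x l ih =>
    rw [List.map_cons, List.lookup_cons]
    by_cases h : a = x
    · simp [h]
    · have hne : (f a == f x) = false := by simpa using hf.ne h
      rw [hne]
      exact ih (List.mem_of_ne_of_mem h ha)

/-! ### Distances and vicinities -/

theorem wellFounded_invImage_lt {α β : Type*} [Finite α] [Preorder β] (f : α → β) :
    WellFounded (InvImage (· < ·) f) :=
  have : IsTrans α (InvImage (· < ·) f) := ⟨fun _ _ _ => lt_trans⟩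
  have : Std.Irrefl (InvImage (· < ·) f) := ⟨fun a => lt_irrefl (f a)⟩
  Finite.wellFounded_of_trans_of_irrefl _

theorem ncard_setOf_ncard_lt_le {α β : Type*} [Finite α] [LinearOrder β] {f : α → β}
    (hf : Function.Injective f) (l : ℕ) : {v | {x | f x < f v}.ncard < l}.ncard ≤ l := by
  have hmono : ∀ {v w}, f v < f w → {x | f x < f v}.ncard < {x | f x < f w}.ncard := fun h =>
    Set.ncard_lt_ncard ⟨fun _ hx => lt_trans hx h, fun hsub => lt_irrefl _ (hsub h)⟩
      (Set.toFinite _)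
  have hinj : Function.Injective fun v => {x | f x < f v}.ncard := fun v w hvw => by
    by_contra hne
    rcases lt_or_gt_of_ne (hf.ne hne) with h | h
    · exact (hmono h).ne hvw
    · exact (hmono h).ne' hvw
  calc {v | {x | f x < f v}.ncard < l}.ncard ≤ (Set.Iio l).ncard :=
        Set.ncard_le_ncard_of_injOn _ (fun _ hv => hv) hinj.injOn (Set.finite_Iio l)
    _ = l := by rw [Set.ncard_eq_toFinset_card', Set.toFinset_Iio, Nat.card_Iio]

namespace WeightedGraph

variable {n : ℕ} (N : WeightedGraph n) {u v w x y z : Fin n} {l : ℕ}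

theorem walkLength_nil : N.walkLength (.nil : N.graph.Walk x x) = 0 := by
  simp [walkLength]

theorem walkLength_cons (h : N.graph.Adj x y) (p : N.graph.Walk y z) :
    N.walkLength (.cons h p) = N.weight s(x, y) + N.walkLength p := by
  simp [walkLength]

theorem walkLength_append (p : N.graph.Walk x y) (q : N.graph.Walk y z) :
    N.walkLength (p.append q) = N.walkLength p + N.walkLength q := by
  simp [walkLength]

theorem walkLength_reverse (p : N.graph.Walk x y) : N.walkLength p.reverse = N.walkLength p := by
  simp [walkLength, List.sum_reverse]

theorem weight_pos_of_adj (h : N.graph.Adj x y) : 0 < N.weight s(x, y) :=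
  N.weight_pos _ h

theorem walkLength_nonneg (p : N.graph.Walk x y) : 0 ≤ N.walkLength p := by
  induction p with
  | nil => exact N.walkLength_nil.ge
  | cons h p ih =>
    rw [walkLength_cons]
    exact add_nonneg (N.weight_pos_of_adj h).le ih

theorem dist_nonneg (x y : Fin n) : 0 ≤ N.dist x y :=
  Real.iInf_nonneg fun p => N.walkLength_nonneg p

theorem dist_le_walkLength (p : N.graph.Walk x y) : N.dist x y ≤ N.walkLength p :=
  ciInf_le ⟨0, Set.forall_mem_range.2 N.walkLength_nonneg⟩ p

theorem le_dist {c : ℝ} (h : ∀ p : N.graph.Walk x y, c ≤ N.walkLength p) : c ≤ N.dist x y :=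
  have : Nonempty (N.graph.Walk x y) := N.connected.preconnected x y
  le_ciInf h

theorem dist_self (x : Fin n) : N.dist x x = 0 :=
  le_antisymm ((N.dist_le_walkLength .nil).trans N.walkLength_nil.le) (N.dist_nonneg x x)

theorem dist_comm (x y : Fin n) : N.dist x y = N.dist y x := by
  have hle : ∀ x y, N.dist x y ≤ N.dist y x := fun x y => N.le_dist fun p =>
    N.walkLength_reverse p ▸ N.dist_le_walkLength p.reverse
  exact le_antisymm (hle x y) (hle y x)

theorem dist_triangle (x y z : Fin n) : N.dist x z ≤ N.dist x y + N.dist y z := by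
  rw [← sub_le_iff_le_add]
  refine N.le_dist fun p => ?_
  rw [sub_le_comm]
  refine N.le_dist fun q => ?_
  linarith [N.dist_le_walkLength (p.append q), N.walkLength_append p q]

theorem dist_le_weight (h : N.graph.Adj x y) : N.dist x y ≤ N.weight s(x, y) := by
  simpa [walkLength] using N.dist_le_walkLength (.cons h .nil)

theorem exists_adj_weight_add_dist_eq (hxy : x ≠ y) :
    ∃ z, N.graph.Adj x z ∧ N.weight s(x, z) + N.dist z y = N.dist x y := by
  have hne : (N.graph.neighborSet x).Nonempty := by
    obtain ⟨p⟩ := N.connected.preconnected x y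
    cases p with
    | nil => exact absurd rfl hxy
    | cons h p => exact ⟨_, h⟩
  obtain ⟨z, hxz : N.graph.Adj x z, hmin⟩ :=
    Set.exists_min_image _ (fun z => N.weight s(x, z) + N.dist z y) (Set.toFinite _) hne
  refine ⟨z, hxz, le_antisymm (N.le_dist fun p => ?_) ?_⟩
  · cases p with
    | nil => exact absurd rfl hxy
    | cons h p =>
      rw [walkLength_cons]
      exact (hmin _ h).trans (by gcongr; exact N.dist_le_walkLength p)
  · exact (N.dist_triangle x z y).trans (by gcongr; exact N.dist_le_weight hxz)

theorem dist_pos (hxy : x ≠ y) : 0 < N.dist x y := by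
  obtain ⟨z, hxz, h⟩ := N.exists_adj_weight_add_dist_eq hxy
  linarith [N.weight_pos_of_adj hxz, N.dist_nonneg z y]

/-- The key by which the vertices are sorted to form the vicinities of `u`: the distance from `u`,
then the name. -/
noncomputable def distLex (u v : Fin n) : ℝ ×ₗ Fin n :=
  toLex (N.dist u v, v)

theorem distLex_lt_distLex :
    N.distLex u x < N.distLex u v ↔
      N.dist u x < N.dist u v ∨ (N.dist u x = N.dist u v ∧ x < v) :=
  Prod.Lex.toLex_lt_toLex

theorem mem_vicinity : v ∈ N.vicinity u l ↔ {x | N.distLex u x < N.distLex u v}.ncard < l := by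
  simp only [distLex_lt_distLex]
  rfl

theorem ncard_vicinity_le (u : Fin n) (l : ℕ) : (N.vicinity u l).ncard ≤ l := by
  have hinj : Function.Injective (N.distLex u) := fun _ _ h => congrArg (fun k => (ofLex k).2) h
  have hset : N.vicinity u l = {v | {x | N.distLex u x < N.distLex u v}.ncard < l} :=
    Set.ext fun _ => N.mem_vicinity
  exact hset ▸ ncard_setOf_ncard_lt_le hinj l

variable {N}

theorem mem_vicinity_of_forall_imp (hv : v ∈ N.vicinity u l)
    (h : ∀ z, N.distLex x z < N.distLex x y → N.distLex u z < N.distLex u v) :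
    y ∈ N.vicinity x l :=
  N.mem_vicinity.2 ((Set.ncard_le_ncard h (Set.toFinite _)).trans_lt (N.mem_vicinity.1 hv))

theorem mem_vicinity_of_dist_lt (hv : v ∈ N.vicinity u l) (h : N.dist u x < N.dist u v) :
    x ∈ N.vicinity u l :=
  mem_vicinity_of_forall_imp hv fun _ hz => hz.trans (N.distLex_lt_distLex.2 (.inl h))

theorem dist_le_of_notMem_vicinity (hv : v ∈ N.vicinity u l) (hx : x ∉ N.vicinity u l) :
    N.dist u v ≤ N.dist u x :=
  le_of_not_gt fun h => hx (mem_vicinity_of_dist_lt hv h)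

theorem self_mem_vicinity (hv : v ∈ N.vicinity u l) : u ∈ N.vicinity u l := by
  by_cases h : u = v
  · exact h ▸ hv
  · exact mem_vicinity_of_dist_lt hv ((N.dist_self u).trans_lt (N.dist_pos h))

theorem mem_vicinity_of_dist_add_dist_eq (hv : v ∈ N.vicinity u l)
    (hx : N.dist u x + N.dist x v = N.dist u v) : v ∈ N.vicinity x l := by
  refine mem_vicinity_of_forall_imp hv fun z hz => ?_
  have htri := N.dist_triangle u x z
  rw [distLex_lt_distLex] at hz ⊢
  rcases hz with hlt | ⟨heq, hname⟩
  · exact .inl (by linarith)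
  · rcases (by linarith : N.dist u z ≤ N.dist u v).lt_or_eq with h | h
    · exact .inl h
    · exact .inr ⟨h, hname⟩

theorem exists_adj_of_mem_vicinity (hv : v ∈ N.vicinity x l) (hxv : x ≠ v) :
    ∃ y ∈ N.vicinity x l, N.graph.Adj y v ∧ N.dist x y + N.weight s(y, v) = N.dist x v := by
  obtain ⟨y, hvy, h⟩ := N.exists_adj_weight_add_dist_eq hxv.symm
  rw [N.dist_comm y, N.dist_comm v, Sym2.eq_swap] at h
  have hpos := N.weight_pos_of_adj hvy.symm
  exact ⟨y, mem_vicinity_of_dist_lt hv (by linarith), hvy.symm, by linarith⟩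

theorem exists_adj_notMem_vicinity (hx : x ∈ N.vicinity x l) (hw : w ∉ N.vicinity x l) :
    ∃ y ∈ N.vicinity x l, ∃ z ∉ N.vicinity x l, N.graph.Adj y z ∧
      N.dist x y + N.weight s(y, z) = N.dist x z ∧ N.dist x z + N.dist z w = N.dist x w := by
  suffices hpath : ∀ y ∈ N.vicinity x l, N.dist x y + N.dist y w = N.dist x w →
      ∃ y ∈ N.vicinity x l, ∃ z ∉ N.vicinity x l, N.graph.Adj y z ∧
        N.dist x y + N.weight s(y, z) = N.dist x z ∧ N.dist x z + N.dist z w = N.dist x w from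
    hpath x hx (by rw [dist_self, zero_add])
  refine (wellFounded_invImage_lt (N.dist · w)).fix fun y ih hy hyw => ?_
  obtain ⟨z, hyz, h⟩ := N.exists_adj_weight_add_dist_eq (ne_of_mem_of_not_mem hy hw)
  have hpos := N.weight_pos_of_adj hyz
  have hweight := N.dist_le_weight hyz
  have hxyz := N.dist_triangle x y z
  have hxzw := N.dist_triangle x z w
  by_cases hz : z ∈ N.vicinity x l
  · exact ih z (show N.dist z w < N.dist y w by linarith) hz (by linarith)
  · exact ⟨y, hy, z, hz, hyz, by linarith, by linarith⟩

theorem dist_le_normalizedDiameter_mul (huw : u ≠ w) (x y : Fin n) :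
    N.dist x y ≤ N.normalizedDiameter * N.dist u w := by
  let distinct := {p : Fin n × Fin n // p.1 ≠ p.2}
  have hmax : N.dist x y ≤ ⨆ p : Fin n × Fin n, N.dist p.1 p.2 :=
    Finite.le_ciSup (fun p : Fin n × Fin n => N.dist p.1 p.2) (x, y)
  have hmin : ⨅ p : distinct, N.dist p.1.1 p.1.2 ≤ N.dist u w :=
    Finite.ciInf_le (fun p : distinct => N.dist p.1.1 p.1.2) ⟨(u, w), huw⟩
  have hpos : 0 < ⨅ p : distinct, N.dist p.1.1 p.1.2 := by
    have : Nonempty distinct := ⟨⟨(u, w), huw⟩⟩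
    obtain ⟨p, hp⟩ := exists_eq_ciInf_of_finite (f := fun p : distinct => N.dist p.1.1 p.1.2)
    exact hp ▸ N.dist_pos p.2
  rw [normalizedDiameter, div_mul_eq_mul_div, le_div_iff₀ hpos]
  exact mul_le_mul hmax hmin hpos.le ((N.dist_nonneg x y).trans hmax)

theorem one_le_normalizedDiameter (huw : u ≠ w) : 1 ≤ N.normalizedDiameter :=
  le_of_mul_le_mul_right (by simpa using dist_le_normalizedDiameter_mul huw u w) (N.dist_pos huw)

variable (N)

theorem logb_normalizedDiameter_nonneg : 0 ≤ Real.logb 2 N.normalizedDiameter := by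
  by_cases h : ∃ u w : Fin n, u ≠ w
  · obtain ⟨u, w, huw⟩ := h
    exact Real.logb_nonneg one_lt_two (one_le_normalizedDiameter huw)
  · have : IsEmpty {p : Fin n × Fin n // p.1 ≠ p.2} := ⟨fun p => h ⟨_, _, p.2⟩⟩
    rw [normalizedDiameter, Real.iInf_of_isEmpty, div_zero, Real.logb_zero]

/-- The quantity `(1 + 1/ε) * (1 + log₂ D)` of the theorem, which bounds the number of waypoints
towards a destination up to a constant factor. -/
noncomputable def waypointBound (ε : ℝ) : ℝ :=
  (1 + 1 / ε) * (1 + Real.logb 2 N.normalizedDiameter)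

theorem one_le_waypointBound {ε : ℝ} (hε : 0 < ε) : 1 ≤ N.waypointBound ε :=
  one_le_mul_of_one_le_of_one_le (by simp [hε.le]) (by simp [N.logb_normalizedDiameter_nonneg])

end WeightedGraph

/-! ### Waypoints -/

theorem exists_nat_lt_one_add_pow {D e : ℝ} (hD : 1 ≤ D) (he : 0 < e) (he1 : e ≤ 1) :
    ∃ m : ℕ, D < (1 + e) ^ m ∧ (m : ℝ) ≤ Real.logb 2 D / e + 1 := by
  have hquot : 0 ≤ Real.logb 2 D / e := div_nonneg (Real.logb_nonneg one_lt_two hD) he.le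
  have hbernoulli : (2 : ℝ) ^ e ≤ 1 + e := by
    simpa [one_add_one_eq_two] using rpow_one_add_le_one_add_mul_self (s := 1) (by simp) he.le he1
  refine ⟨⌊Real.logb 2 D / e⌋₊ + 1, ?_, ?_⟩
  · have hexp : Real.logb 2 D < e * (⌊Real.logb 2 D / e⌋₊ + 1 : ℕ) := by
      rw [← div_lt_iff₀' he]
      exact_mod_cast Nat.lt_floor_add_one _
    calc D = 2 ^ Real.logb 2 D := (Real.rpow_logb two_pos (by simp) (by linarith)).symm
      _ < 2 ^ (e * (⌊Real.logb 2 D / e⌋₊ + 1 : ℕ)) :=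
        Real.rpow_lt_rpow_of_exponent_lt one_lt_two hexp
      _ = ((2 : ℝ) ^ e) ^ (⌊Real.logb 2 D / e⌋₊ + 1) := Real.rpow_mul_natCast two_pos.le _ _
      _ ≤ (1 + e) ^ (⌊Real.logb 2 D / e⌋₊ + 1) := by gcongr
  · push_cast
    gcongr
    exact Nat.floor_le hquot

namespace WeightedGraph

variable {n : ℕ} {N : WeightedGraph n} {port : N.PortNumbering} {l : ℕ}

/-- The waypoints `L` lead from `x` to `t` along a walk of length `c`, each of them lying in the
vicinity of the vertex at which it becomes the next one. -/
inductive Leads (port : N.PortNumbering) (l : ℕ) : Fin n → Waypoints → Fin n → ℝ → Prop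
  | nil (x : Fin n) : Leads port l x [] x 0
  | cons {x y z t : Fin n} {L : Waypoints} {c : ℝ} (hy : y ∈ N.vicinity x l)
      (hyz : N.graph.Adj y z) (hL : Leads port l z L t c) :
      Leads port l x (((y : ℕ), (port y ⟨z, hyz⟩ : ℕ)) :: L) t
        (N.dist x y + N.weight s(y, z) + c)

theorem port_lt {x z : Fin n} (h : N.graph.Adj x z) : (port x ⟨z, h⟩ : ℕ) < n :=
  (port x ⟨z, h⟩).isLt.trans_le <| by simpa using Set.ncard_le_card (N.graph.neighborSet x)

theorem Leads.lt {x t : Fin n} {L : Waypoints} {c : ℝ} (h : Leads port l x L t c) :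
    ∀ e ∈ L, e.1 < n ∧ e.2 < n := by
  induction h with
  | nil => simp
  | cons _ hyz _ ih => exact List.forall_mem_cons.2 ⟨⟨Fin.isLt _, port_lt hyz⟩, ih⟩

theorem exists_leads_of_mem_vicinity {x t : Fin n} (ht : t ∈ N.vicinity x l) :
    ∃ L, Leads port l x L t (N.dist x t) ∧ L.length ≤ 1 := by
  by_cases hxt : x = t
  · subst hxt
    exact ⟨[], by rw [dist_self]; exact .nil x, by simp⟩
  · obtain ⟨y, hy, hyt, hdist⟩ := exists_adj_of_mem_vicinity ht hxt
    exact ⟨_, by simpa [hdist] using Leads.cons hy hyt (.nil t), by simp⟩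

/-- One stage of routing from `u` to `w`, seen from a vertex `x` on a shortest path between them:
the waypoints `L` lead from `x` to `w` or to a vertex of `U` that is closer to `w` than `u`, and the
whole stage, from `u` to `x` and on along `L`, is at most `s` times as long as the distance to `w`
decreases. -/
def LeadsCloser (port : N.PortNumbering) (l : ℕ) (U : Set (Fin n)) (s : ℝ) (u w x : Fin n)
    (L : Waypoints) : Prop :=
  ∃ t c, Leads port l x L t c ∧ t ∈ insert w U ∧ N.dist t w < N.dist u w ∧
    N.dist u x + c ≤ s * (N.dist u w - N.dist t w)

variable {U : Set (Fin n)} {s ε : ℝ} {u w x y z t : Fin n} {L : Waypoints}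

theorem LeadsCloser.lt (h : LeadsCloser port l U s u w x L) : ∀ e ∈ L, e.1 < n ∧ e.2 < n :=
  let ⟨_, _, hL, _⟩ := h
  hL.lt

theorem LeadsCloser.ne_nil (h : LeadsCloser port l U s u w u L) : L ≠ [] := by
  rintro rfl
  obtain ⟨t, c, hL, -, hlt, -⟩ := h
  cases hL
  exact hlt.false

theorem LeadsCloser.cons (hy : y ∈ N.vicinity x l) (hyz : N.graph.Adj y z)
    (hxz : N.dist x y + N.weight s(y, z) = N.dist x z)
    (huz : N.dist u x + N.dist x z = N.dist u z) (h : LeadsCloser port l U s u w z L) :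
    LeadsCloser port l U s u w x (((y : ℕ), (port y ⟨z, hyz⟩ : ℕ)) :: L) := by
  obtain ⟨t, c, hL, ht, hlt, hc⟩ := h
  exact ⟨t, _, .cons hy hyz hL, ht, hlt, by linarith⟩

theorem exists_leadsCloser_of_mem_vicinity (ht : t ∈ N.vicinity x l) (htU : t ∈ insert w U)
    (hlt : N.dist t w < N.dist u w)
    (hs : N.dist u x + N.dist x t ≤ s * (N.dist u w - N.dist t w)) :
    ∃ L, LeadsCloser port l U s u w x L ∧ L.length ≤ 1 := by
  obtain ⟨L, hL, hlen⟩ := exists_leads_of_mem_vicinity (port := port) ht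
  exact ⟨L, ⟨t, _, hL, htU, hlt, hs⟩, hlen⟩

theorem exists_leadsCloser_of_dest_mem_vicinity (hε : 0 ≤ ε) (huw : u ≠ w)
    (hx : N.dist u x + N.dist x w = N.dist u w) (hw : w ∈ N.vicinity x l) :
    ∃ L, LeadsCloser port l U (1 + ε) u w x L ∧ L.length ≤ 1 := by
  have hpos := N.dist_pos huw
  refine exists_leadsCloser_of_mem_vicinity hw (Set.mem_insert w U) ?_ ?_
  · rwa [dist_self]
  · rw [dist_self, hx, sub_zero]
    exact le_mul_of_one_le_left hpos.le (by linarith)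

theorem exists_leadsCloser_of_dist_le (hε : 0 < ε) (hux : u ≠ x)
    (hx : N.dist u x + N.dist x w = N.dist u w) (htU : t ∈ U) (ht : t ∈ N.vicinity x l)
    (hclose : N.dist x t ≤ ε / (2 + ε) * N.dist u x) :
    ∃ L, LeadsCloser port l U (1 + ε) u w x L ∧ L.length ≤ 1 := by
  have hpos := N.dist_pos hux
  have hclose : (2 + ε) * N.dist x t ≤ ε * N.dist u x := by
    rwa [div_mul_eq_mul_div, le_div_iff₀' (by positivity)] at hclose
  have hgain : N.dist u x - N.dist x t ≤ N.dist u w - N.dist t w := by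
    linarith [N.dist_triangle t x w, N.dist_comm t x]
  refine exists_leadsCloser_of_mem_vicinity ht (Set.mem_insert_of_mem w htU) ?_ ?_
  · nlinarith [N.dist_nonneg x t]
  · calc N.dist u x + N.dist x t ≤ (1 + ε) * (N.dist u x - N.dist x t) := by linarith
      _ ≤ (1 + ε) * (N.dist u w - N.dist t w) := by gcongr

theorem exists_leadsCloser_of_dist_lt_mul_pow (hU : ∀ x, ∃ t ∈ N.vicinity x l, t ∈ U)
    (hε : 0 < ε) (huw : u ≠ w) (m : ℕ) (hux : u ≠ x)
    (hx : N.dist u x + N.dist x w = N.dist u w)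
    (hm : ∀ y, N.dist u y < N.dist u x * (1 + ε / (2 + ε)) ^ m) :
    ∃ L, LeadsCloser port l U (1 + ε) u w x L ∧ L.length ≤ m := by
  induction m generalizing x with
  | zero => exact absurd (hm x) (by simp)
  | succ m ih =>
    have of_length_le_one (h : ∃ L, LeadsCloser port l U (1 + ε) u w x L ∧ L.length ≤ 1) :
        ∃ L, LeadsCloser port l U (1 + ε) u w x L ∧ L.length ≤ m + 1 :=
      h.imp fun L hL => hL.imp_right fun hlen => hlen.trans (Nat.le_add_left 1 m)
    obtain ⟨t, ht, htU⟩ := hU x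
    by_cases hw : w ∈ N.vicinity x l
    · exact of_length_le_one (exists_leadsCloser_of_dest_mem_vicinity hε.le huw hx hw)
    by_cases hclose : N.dist x t ≤ ε / (2 + ε) * N.dist u x
    · exact of_length_le_one (exists_leadsCloser_of_dist_le hε hux hx htU ht hclose)
    obtain ⟨y, hy, z, hz, hyz, hxz, hzw⟩ := exists_adj_notMem_vicinity (self_mem_vicinity ht) hw
    have hfar := dist_le_of_notMem_vicinity ht hz
    have huz : N.dist u x + N.dist x z = N.dist u z := by
      linarith [N.dist_triangle u x z, N.dist_triangle u z w]
    have hgrow : N.dist u x * (1 + ε / (2 + ε)) ≤ N.dist u z := by linarith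
    have huz_ne : u ≠ z := fun h => by
      subst h
      linarith [N.dist_pos hux, N.dist_nonneg x u, N.dist_self u]
    obtain ⟨L, hL, hlen⟩ := ih huz_ne (by linarith) fun y => by
      calc N.dist u y < N.dist u x * (1 + ε / (2 + ε)) * (1 + ε / (2 + ε)) ^ m := by
            rw [mul_assoc, ← pow_succ']
            exact hm y
        _ ≤ N.dist u z * (1 + ε / (2 + ε)) ^ m := by gcongr
    exact ⟨_, hL.cons hy hyz hxz huz, by simpa using hlen⟩

theorem exists_leadsCloser_of_normalizedDiameter_lt (hU : ∀ x, ∃ t ∈ N.vicinity x l, t ∈ U)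
    (hε : 0 < ε) (huw : u ≠ w) {m : ℕ} (hm : N.normalizedDiameter < (1 + ε / (2 + ε)) ^ m) :
    ∃ L, LeadsCloser port l U (1 + ε) u w u L ∧ L.length ≤ m + 1 := by
  obtain ⟨t, ht, -⟩ := hU u
  have hu := self_mem_vicinity ht
  by_cases hw : w ∈ N.vicinity u l
  · obtain ⟨L, hL, hlen⟩ := exists_leadsCloser_of_dest_mem_vicinity (port := port) (U := U) hε.le
      huw (by rw [dist_self, zero_add]) hw
    exact ⟨L, hL, by omega⟩
  · obtain ⟨y, hy, z, hz, hyz, huz, hzw⟩ := exists_adj_notMem_vicinity hu hw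
    have huz_ne : u ≠ z := ne_of_mem_of_not_mem hu hz
    obtain ⟨L, hL, hlen⟩ := exists_leadsCloser_of_dist_lt_mul_pow (port := port) hU hε huw m huz_ne
      hzw fun y => calc
        N.dist u y ≤ N.normalizedDiameter * N.dist u z := dist_le_normalizedDiameter_mul huz_ne u y
        _ < (1 + ε / (2 + ε)) ^ m * N.dist u z :=
          mul_lt_mul_of_pos_right hm (N.dist_pos huz_ne)
        _ = N.dist u z * (1 + ε / (2 + ε)) ^ m := mul_comm _ _
    exact ⟨_, hL.cons hy hyz huz (by rw [dist_self, zero_add]), by simpa using hlen⟩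

theorem exists_leadsCloser (hU : ∀ x, ∃ t ∈ N.vicinity x l, t ∈ U) (hε : 0 < ε) (huw : u ≠ w) :
    ∃ L, LeadsCloser port l U (1 + ε) u w u L ∧ (L.length : ℝ) ≤ 2 * N.waypointBound ε := by
  have hlog := N.logb_normalizedDiameter_nonneg
  have hratio : ε / (2 + ε) ≤ 1 := (div_le_one (by positivity)).2 (by linarith)
  obtain ⟨m, hm, hcard⟩ :=
    exists_nat_lt_one_add_pow (one_le_normalizedDiameter huw) (by positivity) hratio
  obtain ⟨L, hL, hlen⟩ := exists_leadsCloser_of_normalizedDiameter_lt (port := port) hU hε huw hm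
  refine ⟨L, hL, ?_⟩
  calc (L.length : ℝ) ≤ m + 1 := by exact_mod_cast hlen
    _ ≤ Real.logb 2 N.normalizedDiameter / (ε / (2 + ε)) + 1 + 1 := by gcongr
    _ = 2 * N.waypointBound ε - Real.logb 2 N.normalizedDiameter - 2 / ε := by
      rw [waypointBound]
      field_simp
      ring
    _ ≤ 2 * N.waypointBound ε := by linarith [div_pos two_pos hε]

end WeightedGraph

/-! ### Routing tables and delivery -/

namespace LocalRouter

variable (R : LocalRouter) {n : ℕ} (N : WeightedGraph n) (port : N.PortNumbering)
  (table : Fin n → List Bool) (H : ℝ)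

/-- A message that is at `x` with the header `h` is delivered at `w` along a walk of length at most
`c`, with headers of at most `H` bits. -/
def Delivers (x w : Fin n) (h : List Bool) (c : ℝ) : Prop :=
  ∃ p : N.graph.Walk x w, R.Traverses N port table H p h ∧ N.walkLength p ≤ c

variable {R N port table H} {x z w : Fin n} {h h' : List Bool} {c c' : ℝ}

theorem Delivers.mono (hd : R.Delivers N port table H x w h c) (hc : c ≤ c') :
    R.Delivers N port table H x w h c' :=
  hd.imp fun _ hp => ⟨hp.1, hp.2.trans hc⟩

theorem Delivers.of_step_eq_none (hh : (h.length : ℝ) ≤ H) (hs : R.step (table w) h = none) :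
    R.Delivers N port table H w w h 0 :=
  ⟨.nil, by rw [Traverses]; exact ⟨hh, hs⟩, N.walkLength_nil.le⟩

theorem Delivers.cons (hh : (h.length : ℝ) ≤ H) (hxz : N.graph.Adj x z)
    (hs : R.step (table x) h = some ((port x ⟨z, hxz⟩ : ℕ), h'))
    (hd : R.Delivers N port table H z w h' c) :
    R.Delivers N port table H x w h (N.weight s(x, z) + c) := by
  obtain ⟨p, hp, hc⟩ := hd
  refine ⟨.cons hxz p, by rw [Traverses]; exact ⟨hh, h', hs, hp⟩, ?_⟩
  rw [N.walkLength_cons]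
  gcongr

theorem Delivers.of_step_eq (hh : (h.length : ℝ) ≤ H)
    (hs : R.step (table x) h = R.step (table x) h') (hd : R.Delivers N port table H x w h' c) :
    R.Delivers N port table H x w h c := by
  obtain ⟨p, hp, hc⟩ := hd
  refine ⟨p, ?_, hc⟩
  cases p <;> (rw [Traverses] at hp ⊢; exact ⟨hh, hs ▸ hp.2⟩)

end LocalRouter

namespace WeightedGraph

variable {n : ℕ} {N : WeightedGraph n} (port : N.PortNumbering) (l : ℕ)
  (dest : Fin n → Finset (Fin n)) (way : Fin n → Fin n → Waypoints) {u w x y z t : Fin n}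

open Classical in
/-- The number of a port at `x` that starts a shortest path to `v`; the value at `x = v` is
arbitrary. -/
noncomputable def portTowards (x v : Fin n) : ℕ :=
  if h : x = v then 0
  else port x ⟨_, (N.exists_adj_weight_add_dist_eq h).choose_spec.1⟩

variable {port} in
theorem exists_portTowards_eq (hxy : x ≠ y) :
    ∃ z, ∃ hxz : N.graph.Adj x z, portTowards port x y = port x ⟨z, hxz⟩ ∧
      N.weight s(x, z) + N.dist z y = N.dist x y :=
  have hz := (N.exists_adj_weight_add_dist_eq hxy).choose_spec
  ⟨_, hz.1, dif_neg hxy, hz.2⟩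

variable {port} in
theorem portTowards_lt : portTowards port x y < n := by
  by_cases hxy : x = y
  · rw [portTowards, dif_pos hxy]
    exact x.pos
  · obtain ⟨z, hxz, hport, -⟩ := exists_portTowards_eq (port := port) hxy
    exact hport ▸ port_lt hxz

/-- The routing table of `u`: shortest-path ports for the vicinity of size `l` of `u`, and the
waypoints `way u w` for the destinations `w ∈ dest u`. -/
noncomputable def routingTable (u : Fin n) : RoutingTable where
  name := u
  ports := (N.vicinity u l).toFinite.toFinset.toList.map fun v : Fin n => (v, portTowards port u v)
  routes := ((dest u).erase u).toList.map fun w : Fin n => (w, way u w)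

variable {port l dest way}

theorem length_encode_routingTable_le (hn : 2 ≤ n) {K : ℝ} (hK : 0 ≤ K)
    (hway : ∀ w ∈ dest u, w ≠ u → ((way u w).length : ℝ) ≤ K ∧ ∀ e ∈ way u w, e.1 < n ∧ e.2 < n) :
    ((tableCode.encode (routingTable port l dest way u)).length : ℝ) ≤
      (7 + 11 * l + (7 + 11 * K) * (dest u).card) * Real.logb 2 n := by
  have hlog : 1 ≤ Real.logb 2 n := one_le_logb_two (by exact_mod_cast hn)
  have hports : (routingTable port l dest way u).ports.length ≤ l := by
    simpa [routingTable, ← Set.ncard_eq_toFinset_card] using N.ncard_vicinity_le u l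
  have hroutes : (routingTable port l dest way u).routes.length ≤ (dest u).card := by
    simpa [routingTable] using Finset.card_erase_le
  refine (length_encode_tableCode_le (K := K) hn u.isLt ?_ ?_).trans (by gcongr)
  · simp only [routingTable, List.forall_mem_map]
    exact fun v _ => ⟨v.isLt, portTowards_lt⟩
  · simp only [routingTable, List.forall_mem_map, Finset.mem_toList, Finset.mem_erase]
    exact fun w hw => ⟨w.isLt, hway w hw.2 hw.1⟩

theorem step_routingTable_self (w : Fin n) :
    (routingTable port l dest way w).step ⟨w, []⟩ = none := by
  simp [RoutingTable.step, routingTable]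

theorem step_routingTable_of_mem_dest (hxw : x ≠ w) (hw : w ∈ dest x) (hne : way x w ≠ []) :
    (routingTable port l dest way x).step ⟨w, []⟩ =
      (routingTable port l dest way x).step ⟨w, way x w⟩ := by
  have hlookup : (routingTable port l dest way x).routes.lookup (w : ℕ) = some (way x w) :=
    lookup_map_mk_of_injective Fin.val_injective (way x)
      (Finset.mem_toList.2 (Finset.mem_erase.2 ⟨hxw.symm, hw⟩))
  have hname : ¬(routingTable port l dest way x).name = w := Fin.val_injective.ne hxw
  obtain ⟨e, L, hL⟩ := List.exists_cons_of_ne_nil hne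
  simp only [RoutingTable.step, if_neg hname, hlookup, hL, Option.bind_some]

theorem step_routingTable_at_waypoint (x w : Fin n) (p : ℕ) (L : Waypoints) :
    (routingTable port l dest way x).step ⟨w, (x, p) :: L⟩ = some (p, ⟨w, L⟩) := by
  simp [RoutingTable.step, RoutingTable.forward, routingTable]

theorem step_routingTable_of_mem_vicinity (hxy : x ≠ y) (hy : y ∈ N.vicinity x l) (w : Fin n)
    (p : ℕ) (L : Waypoints) :
    (routingTable port l dest way x).step ⟨w, (y, p) :: L⟩ =
      some (portTowards port x y, ⟨w, (y, p) :: L⟩) := by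
  have hlookup : (routingTable port l dest way x).ports.lookup (y : ℕ) =
      some (portTowards port x y) :=
    lookup_map_mk_of_injective Fin.val_injective (portTowards port x)
      (Finset.mem_toList.2 ((Set.Finite.mem_toFinset _).2 hy))
  have hname : ¬(routingTable port l dest way x).name = y := Fin.val_injective.ne hxy
  simp only [RoutingTable.step, RoutingTable.forward, if_neg hname, hlookup, Option.map_some]

/-- The delivery, along a walk of length at most `c`, of a message to `w` that is at `x` with the
waypoints `L` ahead, when every vertex holds its `routingTable`. -/
def WaypointDelivers (port : N.PortNumbering) (l : ℕ) (dest : Fin n → Finset (Fin n))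
    (way : Fin n → Fin n → Waypoints) (H : ℝ) (x w : Fin n) (L : Waypoints) (c : ℝ) : Prop :=
  waypointRouter.Delivers N port (fun u => tableCode.encode (routingTable port l dest way u)) H x w
    (headerCode.encode ⟨w, L⟩) c

variable {H K c : ℝ} {L : Waypoints}

theorem WaypointDelivers.self (hH : ((headerCode.encode ⟨w, []⟩).length : ℝ) ≤ H) :
    WaypointDelivers port l dest way H w w [] 0 :=
  .of_step_eq_none hH (by rw [waypointRouter_step_encode, step_routingTable_self, Option.map_none])

theorem WaypointDelivers.of_mem_dest (hH : ((headerCode.encode ⟨w, []⟩).length : ℝ) ≤ H)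
    (hxw : x ≠ w) (hw : w ∈ dest x) (hne : way x w ≠ [])
    (hd : WaypointDelivers port l dest way H x w (way x w) c) :
    WaypointDelivers port l dest way H x w [] c := by
  refine .of_step_eq hH ?_ hd
  rw [waypointRouter_step_encode, waypointRouter_step_encode,
    step_routingTable_of_mem_dest hxw hw hne]

theorem WaypointDelivers.cons (hyz : N.graph.Adj y z)
    (hH : ((headerCode.encode ⟨w, ((y : ℕ), (port y ⟨z, hyz⟩ : ℕ)) :: L⟩).length : ℝ) ≤ H)
    (hd : WaypointDelivers port l dest way H z w L c) (hy : y ∈ N.vicinity x l) :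
    WaypointDelivers port l dest way H x w (((y : ℕ), (port y ⟨z, hyz⟩ : ℕ)) :: L)
      (N.dist x y + (N.weight s(y, z) + c)) := by
  induction x using (wellFounded_invImage_lt (N.dist · y)).induction with | h x ih
  by_cases hxy : x = y
  · subst hxy
    rw [dist_self, zero_add]
    refine .cons hH hyz ?_ hd
    rw [waypointRouter_step_encode, step_routingTable_at_waypoint, Option.map_some]
  · obtain ⟨x', hxx', hport, hdist⟩ := exists_portTowards_eq (port := port) hxy
    have hpos := N.weight_pos_of_adj hxx'
    have hcloser : N.dist x' y < N.dist x y := by linarith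
    have hpath : N.dist x x' + N.dist x' y = N.dist x y :=
      le_antisymm (by linarith [N.dist_le_weight hxx']) (N.dist_triangle x x' y)
    have hstep : waypointRouter.step (tableCode.encode (routingTable port l dest way x))
        (headerCode.encode ⟨w, ((y : ℕ), (port y ⟨z, hyz⟩ : ℕ)) :: L⟩) =
          some ((port x ⟨x', hxx'⟩ : ℕ),
            headerCode.encode ⟨w, ((y : ℕ), (port y ⟨z, hyz⟩ : ℕ)) :: L⟩) := by
      rw [waypointRouter_step_encode, step_routingTable_of_mem_vicinity hxy hy, hport,
        Option.map_some]
    exact (LocalRouter.Delivers.cons hH hxx' hstep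
      (ih x' hcloser (mem_vicinity_of_dist_add_dist_eq hy hpath))).mono (by linarith)

theorem length_encode_header_le (hn : 2 ≤ n) (hH : (6 + 11 * K) * Real.logb 2 n ≤ H)
    (hlen : (L.length : ℝ) ≤ K) (hL : ∀ e ∈ L, e.1 < n ∧ e.2 < n) (w : Fin n) :
    ((headerCode.encode ⟨w, L⟩).length : ℝ) ≤ H := by
  have hlog : 1 ≤ Real.logb 2 n := one_le_logb_two (by exact_mod_cast hn)
  exact ((length_encode_headerCode_le hn w.isLt hL).trans (by dsimp only; gcongr)).trans hH

theorem WaypointDelivers.of_leads (hn : 2 ≤ n) (hH : (6 + 11 * K) * Real.logb 2 n ≤ H)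
    {c' : ℝ} (hL : Leads port l x L t c) (hlen : (L.length : ℝ) ≤ K)
    (hd : WaypointDelivers port l dest way H t w [] c') :
    WaypointDelivers port l dest way H x w L (c + c') := by
  induction hL with
  | nil x => simpa using hd
  | cons hy hyz hL ih =>
    have hheader := length_encode_header_le hn hH hlen (Leads.cons hy hyz hL).lt w
    rw [List.length_cons, Nat.cast_succ] at hlen
    rw [add_assoc, add_assoc]
    exact .cons hyz hheader (ih (by linarith) hd) hy

theorem WaypointDelivers.of_leadsCloser (hn : 2 ≤ n) (hK : 0 ≤ K)
    (hH : (6 + 11 * K) * Real.logb 2 n ≤ H) {s : ℝ}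
    (hway : ∀ u, w ∈ dest u → u ≠ w →
      LeadsCloser port l {t | w ∈ dest t} s u w u (way u w) ∧ ((way u w).length : ℝ) ≤ K)
    (u : Fin n) (hu : w ∈ dest u) :
    WaypointDelivers port l dest way H u w [] (s * N.dist u w) := by
  have hempty : ((headerCode.encode ⟨w, []⟩).length : ℝ) ≤ H :=
    length_encode_header_le hn hH (by simpa using hK) (by simp) w
  have hself : WaypointDelivers port l dest way H w w [] (s * N.dist w w) := by
    rw [dist_self, mul_zero]
    exact .self hempty
  induction u using (wellFounded_invImage_lt (N.dist · w)).induction with | h u ih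
  by_cases huw : u = w
  · exact huw ▸ hself
  · obtain ⟨hcloser, hlen⟩ := hway u hu huw
    have hne := hcloser.ne_nil
    obtain ⟨t, c, hL, ht, hlt, hc⟩ := hcloser
    have hd : WaypointDelivers port l dest way H t w [] (s * N.dist t w) :=
      ht.elim (fun h => h ▸ hself) (ih t hlt)
    rw [dist_self] at hc
    exact .of_mem_dest hempty huw hu hne ((WaypointDelivers.of_leads hn hH hL hlen hd).mono
      (by linarith))

theorem exists_tables_routesWithStretch (port : N.PortNumbering) (hn : 2 ≤ n)
    (hdest : ∀ u, ∀ w ∈ dest u, ∀ x, ∃ t ∈ N.vicinity x l, w ∈ dest t) {ε : ℝ} (hε : 0 < ε) :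
    ∃ table : Fin n → List Bool,
      (∀ u, ((table u).length : ℝ) ≤
        (7 + 11 * l + 29 * N.waypointBound ε * (dest u).card) * Real.logb 2 n) ∧
      ∀ u, ∀ w ∈ dest u, waypointRouter.RoutesWithStretch N port table
        (28 * (N.waypointBound ε * Real.logb 2 n)) (1 + ε) u w := by
  have hlog : 1 ≤ Real.logb 2 n := one_le_logb_two (by exact_mod_cast hn)
  have hone := N.one_le_waypointBound hε
  have hexists : ∀ u w, w ∈ dest u → u ≠ w → ∃ L : Waypoints,
      LeadsCloser port l {t | w ∈ dest t} (1 + ε) u w u L ∧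
        (L.length : ℝ) ≤ 2 * N.waypointBound ε :=
    fun u w hw huw => exists_leadsCloser (hdest u w hw) hε huw
  choose! way hway using hexists
  refine ⟨fun u => tableCode.encode (routingTable port l dest way u), fun u => ?_,
    fun u w hw => ?_⟩
  · have hroutes : ∀ w ∈ dest u, w ≠ u → ((way u w).length : ℝ) ≤ 2 * N.waypointBound ε ∧
        ∀ e ∈ way u w, e.1 < n ∧ e.2 < n := fun w hw hwu =>
      ⟨(hway u w hw hwu.symm).2, (hway u w hw hwu.symm).1.lt⟩
    refine (length_encode_routingTable_le hn (by linarith) hroutes).trans ?_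
    gcongr
    linarith
  · have hheader : (6 + 11 * (2 * N.waypointBound ε)) * Real.logb 2 n ≤
        28 * (N.waypointBound ε * Real.logb 2 n) := by
      calc _ ≤ 28 * N.waypointBound ε * Real.logb 2 n := by gcongr; linarith
        _ = _ := mul_assoc ..
    exact WaypointDelivers.of_leadsCloser hn (by linarith) hheader (fun u => hway u w) u hw

end WeightedGraph

theorem card_biUnion_filter_mem_le_of_pairwise_disjoint {ι α β : Type*} [Fintype ι] [DecidableEq α]
    [DecidableEq β] {U : ι → Finset α} {W : ι → Finset β}
    (hU : Pairwise fun i j => Disjoint (U i) (U j)) {b : ℝ} (hb : 0 ≤ b)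
    (hW : ∀ i, ((W i).card : ℝ) ≤ b) (u : α) :
    (((Finset.univ.filter (u ∈ U ·)).biUnion W).card : ℝ) ≤ b := by
  have hone : (Finset.univ.filter (u ∈ U ·)).card ≤ 1 := Finset.card_le_one.2 fun i hi j hj => by
    by_contra hne
    exact Finset.disjoint_left.1 (hU hne) (Finset.mem_filter.1 hi).2 (Finset.mem_filter.1 hj).2
  calc (((Finset.univ.filter (u ∈ U ·)).biUnion W).card : ℝ)
      ≤ ∑ i ∈ Finset.univ.filter (u ∈ U ·), ((W i).card : ℝ) := by
        exact_mod_cast Finset.card_biUnion_le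
    _ ≤ (Finset.univ.filter (u ∈ U ·)).card * b := by
        simpa using Finset.sum_le_card_nsmul _ _ b fun i _ => hW i
    _ ≤ b := mul_le_of_le_one_left hb (by exact_mod_cast hone)

theorem tableSize_le {α A q lg S r l d : ℝ} {a : ℕ} (hα : 0 ≤ α) (hA : 0 ≤ A) (hq : 1 ≤ q)
    (hlg : 1 ≤ lg) (hS : 0 ≤ S) (hr : 0 ≤ r) (hl : l ≤ α * q * lg + 1)
    (hd : d ≤ A * lg ^ a * r) :
    (7 + 11 * l + 29 * S * d) * lg ≤ (18 + 11 * α + 29 * A) * lg ^ (a + 2) * (q + S * r) := by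
  have hpow : 1 ≤ lg ^ a := one_le_pow₀ hlg
  have hqlg : 1 ≤ q * lg := one_le_mul_of_one_le_of_one_le hq hlg
  calc (7 + 11 * l + 29 * S * d) * lg
      ≤ (7 + 11 * (α * q * lg + 1) + 29 * S * (A * lg ^ a * r)) * lg := by gcongr
    _ = (18 * 1 + 11 * α * (q * lg) + 29 * A * (lg ^ a * (S * r))) * lg := by ring
    _ ≤ (18 * (q * lg) + 11 * α * (q * lg) + 29 * A * (lg ^ a * (S * r))) * lg := by gcongr
    _ = ((18 + 11 * α) * (q * 1 * lg) + 29 * A * (lg ^ a * 1 * (S * r))) * lg := by ring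
    _ ≤ ((18 + 11 * α) * (q * lg ^ a * lg) + 29 * A * (lg ^ a * lg * (S * r))) * lg := by gcongr
    _ = ((18 + 11 * α) * q + 29 * A * (S * r)) * lg ^ (a + 2) := by ring
    _ ≤ ((18 + 11 * α) * q + 29 * A * (S * r) + (29 * A * q + (18 + 11 * α) * (S * r))) *
          lg ^ (a + 2) :=
        mul_le_mul_of_nonneg_right (le_add_of_nonneg_right (by positivity)) (by positivity)
    _ = (18 + 11 * α + 29 * A) * lg ^ (a + 2) * (q + S * r) := by ring

theorem WeightedGraph.two_le_of_vicinity_logb_nonempty {n : ℕ} {N : WeightedGraph n} {u v : Fin n}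
    {c : ℝ} (hv : v ∈ N.vicinity u ⌈c * Real.logb 2 n⌉₊) : 2 ≤ n := by
  by_contra hn
  have hn1 : n = 1 := by have := u.pos; omega
  have hlog : Real.logb 2 n = 0 := by simp [hn1]
  rw [hlog, mul_zero, Nat.ceil_zero] at hv
  exact absurd (N.mem_vicinity.1 hv) (Nat.not_lt_zero _)

theorem mainTheorem6_general :
    ∃ (R : LocalRouter) (C₁ : ℝ), ∀ (α A : ℝ) (a : ℕ), 0 < α →
      ∃ (C₂ : ℝ) (k : ℕ),
        ∀ (n q : ℕ) (N : WeightedGraph n) (port : N.PortNumbering) (r : ℝ)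
          (W U : Fin q → Finset (Fin n)),
          0 ≤ r →
          (∀ i, ((W i).card : ℝ) ≤ A * Real.logb 2 n ^ a * r) →
          (Pairwise fun i j => Disjoint (U i) (U j)) →
          (∀ i u, ∃ v ∈ U i, v ∈ N.vicinity u ⌈α * (q : ℝ) * Real.logb 2 n⌉₊) →
          ∀ ε : ℝ, 0 < ε →
            ∃ table : Fin n → List Bool,
              (∀ u, ((table u).length : ℝ) ≤
                C₂ * Real.logb 2 n ^ k *
                  ((q : ℝ) + (1 + 1 / ε) * (1 + Real.logb 2 N.normalizedDiameter) * r)) ∧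
              ∀ i, ∀ u ∈ U i, ∀ w ∈ W i,
                R.RoutesWithStretch N port table
                  (C₁ * ((1 + 1 / ε) * (1 + Real.logb 2 N.normalizedDiameter) * Real.logb 2 n))
                  (1 + ε) u w := by
  refine ⟨waypointRouter, 28, fun α A a hα => ⟨18 + 11 * α + 29 * |A|, a + 2,
    fun n q N port r W U hr hW hU hmeet ε hε => ?_⟩⟩
  have hone := N.one_le_waypointBound hε
  by_cases hsize : 2 ≤ n ∧ 1 ≤ q
  · obtain ⟨hn, hq⟩ := hsize
    have hlog : 1 ≤ Real.logb 2 n := one_le_logb_two (by exact_mod_cast hn)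
    have hcard : ∀ i, ((W i).card : ℝ) ≤ |A| * Real.logb 2 n ^ a * r := fun i =>
      (hW i).trans (by gcongr; exact le_abs_self A)
    let dest : Fin n → Finset (Fin n) := fun u => (Finset.univ.filter (u ∈ U ·)).biUnion W
    have mem_dest : ∀ {u w}, w ∈ dest u ↔ ∃ i, u ∈ U i ∧ w ∈ W i := by simp [dest]
    obtain ⟨table, hbits, hroutes⟩ := WeightedGraph.exists_tables_routesWithStretch port hn
      (dest := dest) (l := ⌈α * (q : ℝ) * Real.logb 2 n⌉₊) (fun u w hw x => by
        obtain ⟨i, -, hwi⟩ := mem_dest.1 hw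
        obtain ⟨t, ht, htx⟩ := hmeet i x
        exact ⟨t, htx, mem_dest.2 ⟨i, ht, hwi⟩⟩) hε
    exact ⟨table, fun u => (hbits u).trans <| tableSize_le hα.le (abs_nonneg A)
        (by exact_mod_cast hq) hlog (by linarith) hr (Nat.ceil_lt_add_one (by positivity)).le
        (card_biUnion_filter_mem_le_of_pairwise_disjoint hU (by positivity) hcard u),
      fun i u hu w hw => hroutes u w (mem_dest.2 ⟨i, hu, hw⟩)⟩
  · refine ⟨fun _ => [], fun u => ?_, fun i u _ => ?_⟩
    · have hlog : 0 ≤ Real.logb 2 n := Real.logb_nonneg one_lt_two (by exact_mod_cast u.pos)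
      rw [List.length_nil, Nat.cast_zero]
      exact mul_nonneg (by positivity)
        (add_nonneg q.cast_nonneg (mul_nonneg (zero_le_one.trans hone) hr))
    · obtain ⟨v, -, hv⟩ := hmeet i u
      exact absurd ⟨N.two_le_of_vicinity_logb_nonempty hv, i.pos⟩ hsize

theorem mainTheorem6 :
    ∃ (R : LocalRouter) (C₁ : ℝ), ∀ (α A : ℝ) (a : ℕ), 0 < α →
      ∃ (C₂ : ℝ) (k : ℕ),
        ∀ (n q : ℕ) (N : WeightedGraph n) (port : N.PortNumbering)
          (W : Finset (Fin n)) (Wpart Upart : Fin q → Finset (Fin n)),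
          IsIndexedPartition Wpart W →
          (∀ i : Fin q, ((Wpart i).card : ℝ) ≤
            A * Real.logb 2 n ^ a * ((W.card : ℝ) / (q : ℝ))) →
          IsIndexedPartition Upart Finset.univ →
          (∀ (i : Fin q) (u : Fin n),
            ∃ v ∈ Upart i, v ∈ N.vicinity u ⌈α * (q : ℝ) * Real.logb 2 n⌉₊) →
          ∀ ε : ℝ, 0 < ε →
            ∃ table : Fin n → List Bool,
              (∀ u : Fin n, ((table u).length : ℝ) ≤
                C₂ * Real.logb 2 n ^ k *
                  ((q : ℝ) + (1 + 1 / ε) * (1 + Real.logb 2 N.normalizedDiameter) *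
                    ((W.card : ℝ) / (q : ℝ)))) ∧
              ∀ (i : Fin q), ∀ u ∈ Upart i, ∀ w ∈ Wpart i,
                R.RoutesWithStretch N port table
                  (C₁ * ((1 + 1 / ε) * (1 + Real.logb 2 N.normalizedDiameter) * Real.logb 2 n))
                  (1 + ε) u w := by
  obtain ⟨R, C₁, h⟩ := mainTheorem6_general
  exact ⟨R, C₁, fun α A a hα => (h α A a hα).imp fun _ => Exists.imp
    fun _ h n q N port W Wpart Upart _ hW hU =>
      h n q N port _ Wpart Upart (by positivity) hW fun i j => hU.1 i j⟩
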